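/- Let $\mathbb{N}=\{0,1,2,\dots\}$. For $n\in\mathbb{N}$ let $b(n)$ be the number of partitions of $n$ into parts that are powers of two ($1,2,4,8,\dots$). Let $s_2(n)$ be the number of ones in the binary expansion of $n$, let $t_n=(-1)^{s_2(n)}\in\{1,-1\}$, and let $T_n\in\{0,1\}$ be the residue of $s_2(n)$ modulo $2$. Let $\chi:\mathbb{N}\to\mathbb{N}$ be the unique sequence such that $\chi(0)=0$ and, for all $n\in\mathbb{N}$, $$\chi(2n+1)=0,\quad \chi(4n)=\chi(n),\quad \chi(8n+2)=T_n,\quad \chi(8n+6)=0.$$ Put $$S_1=\{n\in\mathbb{N}: b(n)\ne x^2+y^2+z^2 \text{ for all } x,y,z\in\mathbb{Z}\},\qquad S_1'=\{n\in\mathbb{N}: 2n\in S_1\}.$$ A sequence $(a_n)_{n\in\mathbb{N}}$ is called $2$-automatic if the set of sequences $\{(a_{2^jn+i})_{n\in\mathbb{N}}: j,i\in\mathbb{N},\ 0\le i<2^j\}$ is finite, and a set $A\subseteq\mathbb{N}$ is called $2$-automatic if its characteristic sequence (with value $1$ on $A$ and $0$ off $A$) is $2$-automatic. (1) For every $n\in\mathbb{N}$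 the following conditions are equivalent: (a) $b(2n)$ is not a sum of three squares of integers; (b) $n=2^{2k+1}(4s+1)$ for some $k,s\in\mathbb{N}$ such that $t_s=-1$; (c) $n=2^{2k+1}(8r+2t_r+3)$ for some $k,r\in\mathbb{N}$; (d) $\chi(n)=1$. (2) For every $n\in\mathbb{N}$ one has $b(2n+1)=b(2n)$, and $$S_1=\{2n:n\in S_1'\}\cup\{2n+1:n\in S_1'\}=\{2^{2k+2}(8r+2t_r+3)+i:\ k,r\in\mathbb{N},\ i\in\{0,1\}\}.$$ (3) The sequence $\chi$ is the characteristic sequence of $S_1'$ and is $2$-automatic; that is, $S_1'$ is a $2$-automatic set. The set $S_1$ is also $2$-automatic. -/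

import Mathlib

namespace BinaryPartition

/-- The binary partition function: the number of partitions of `n` all of whose parts are powers
of two. -/
def b (n : ℕ) : ℕ := (Nat.Partition.restricted n Nat.isPowerOfTwo).card

/-- The integer `m` is a sum of three squares of integers. -/
def IsSumThreeSquares (m : ℤ) : Prop := ∃ x y z : ℤ, m = x ^ 2 + y ^ 2 + z ^ 2

/-- The set of `n` such that `b n` is not a sum of three squares. -/
def S₁ : Set ℕ := {n | ¬ IsSumThreeSquares (b n)}

/-- The set of `n` such that `b (2 * n)` is not a sum of three squares. -/
def S₁' : Set ℕ := {n | ¬ IsSumThreeSquares (b (2 * n))}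

/-- The sum of the binary digits of `n`, i.e. the number of ones in its binary expansion. -/
def s₂ (n : ℕ) : ℕ := (Nat.digits 2 n).sum

/-- The Prouhet-Thue-Morse sequence with values `1` and `-1`. -/
def t (n : ℕ) : ℤ := (-1) ^ s₂ n

/-- The Prouhet-Thue-Morse sequence with values `0` and `1`. -/
def T (n : ℕ) : ℕ := s₂ n % 2

/-- The sequence with `χ 0 = 0`, `χ (2 n + 1) = 0`, `χ (4 n) = χ n`, `χ (8 n + 2) = T n` and
`χ (8 n + 6) = 0`; the theorem `eq_χ_iff` below shows that it is the only one. -/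
def χ (n : ℕ) : ℕ :=
  if n = 0 then 0
  else if n % 2 = 1 then 0
  else if n % 4 = 0 then χ (n / 4)
  else if n % 8 = 2 then T (n / 8)
  else 0
termination_by n
decreasing_by omega

theorem χ_zero : χ 0 = 0 := by
  rw [χ]; simp

theorem χ_two_mul_add_one (n : ℕ) : χ (2 * n + 1) = 0 := by
  rw [χ, if_neg (by omega), if_pos (by omega)]

theorem χ_four_mul (n : ℕ) : χ (4 * n) = χ n := by
  rcases Nat.eq_zero_or_pos n with rfl | hn
  · simp
  · rw [χ, if_neg (by omega), if_neg (by omega), if_pos (by omega),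
      Nat.mul_div_cancel_left n (by norm_num)]

theorem χ_eight_mul_add_two (n : ℕ) : χ (8 * n + 2) = T n := by
  rw [χ, if_neg (by omega), if_neg (by omega), if_neg (by omega), if_pos (by omega)]
  congr 1
  omega

theorem χ_eight_mul_add_six (n : ℕ) : χ (8 * n + 6) = 0 := by
  rw [χ, if_neg (by omega), if_neg (by omega), if_neg (by omega), if_neg (by omega)]

theorem eq_χ_iff (f : ℕ → ℕ) :
    f = χ ↔ f 0 = 0 ∧ (∀ n, f (2 * n + 1) = 0) ∧ (∀ n, f (4 * n) = f n) ∧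
      (∀ n, f (8 * n + 2) = T n) ∧ (∀ n, f (8 * n + 6) = 0) := by
  constructor
  · rintro rfl
    exact ⟨χ_zero, χ_two_mul_add_one, χ_four_mul, χ_eight_mul_add_two, χ_eight_mul_add_six⟩
  · rintro ⟨h0, h1, h4, h2, h6⟩
    funext n
    induction n using Nat.strong_induction_on with
    | _ n ih =>
      rcases Nat.eq_zero_or_pos n with rfl | hn
      · rw [h0, χ_zero]
      have hc : n % 2 = 1 ∨ n % 4 = 0 ∨ n % 8 = 2 ∨ n % 8 = 6 := by omega
      rcases hc with h | h | h | h
      · obtain ⟨m, rfl⟩ : ∃ m, n = 2 * m + 1 := ⟨n / 2, by omega⟩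
        rw [h1, χ_two_mul_add_one]
      · obtain ⟨m, rfl⟩ : ∃ m, n = 4 * m := ⟨n / 4, by omega⟩
        rw [h4, χ_four_mul, ih m (by omega)]
      · obtain ⟨m, rfl⟩ : ∃ m, n = 8 * m + 2 := ⟨n / 8, by omega⟩
        rw [h2, χ_eight_mul_add_two]
      · obtain ⟨m, rfl⟩ : ∃ m, n = 8 * m + 6 := ⟨n / 8, by omega⟩
        rw [h6, χ_eight_mul_add_six]

/-- The `k`-kernel of a sequence: all subsequences `n ↦ a (k ^ j * n + i)` with `i < k ^ j`. -/
def kernel {α : Type*} (k : ℕ) (a : ℕ → α) : Set (ℕ → α) :=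
  {s | ∃ j i : ℕ, i < k ^ j ∧ s = fun n => a (k ^ j * n + i)}

/-- A sequence is `k`-automatic, for `k ≥ 2`, if its `k`-kernel is a finite set. -/
def IsAutomatic {α : Type*} (k : ℕ) (a : ℕ → α) : Prop :=
  2 ≤ k ∧ (kernel k a).Finite

/-- The characteristic sequence of a set of natural numbers. -/
noncomputable def charSeq (A : Set ℕ) : ℕ → ℕ := A.indicator 1

/-- A set of natural numbers is `k`-automatic if its characteristic sequence is. -/
def IsAutomaticSet (k : ℕ) (A : Set ℕ) : Prop := IsAutomatic k (charSeq A)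

end BinaryPartition

/-!
Write `a n = b (2 n)`. The recurrences `b (2 n + 1) = b (2 n)` and
`b (2 n + 2) = b (2 n) + b (n + 1)`, obtained by removing a part `1` or halving all parts, give
`a n = a (n - 1) + a ⌊n / 2⌋`. From this, induction yields `a (4 n) ≡ a n` modulo `8` and
`a (8 n) ≡ a (2 n)` modulo `32`, and, with the signs `t` of the Thue–Morse sequence,
`a (2 n + 1) ≡ 2 t n` modulo `8`, `a (8 n + 2) ≡ 4 t n` and `a (8 n + 6) ≡ 20 t n` modulo `32`.
The signs come from `bEven_four_mul_add_bEven_two_mul`. So for `n > 0` the number `a n` is twice an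
odd number or four times an odd number, and it has the form `4 (8 r + 7)` exactly when
`n = 4 ^ k (8 s + 2)` with `t s = -1`, that is, when `χ n = 1` (`bEven_residue_cases`).

It remains to know which numbers are sums of three squares. Numbers congruent to `28` modulo `32`
are not. Conversely, `isSumThreeSquares_of_mod_eight` proves that every `n` that is not
congruent to `0`, `4` or `7` modulo `8` is one, by Dirichlet's argument: a positive definite integral
ternary form of determinant one takes only sums of three squares as values
(`TernaryForm.isSumThreeSquares_eval`, by reduction of forms), and `n` is a value of such a form as
soon as some `-d` is a square modulo `d n - 1`
(`isSumThreeSquares_of_dvd_sq_add`). Dirichlet's theorem on primes in arithmetic progressions makes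
`d n - 1` a prime or twice a prime, and quadratic reciprocity for the Jacobi symbol shows that
`-d` is a square.

Automaticity follows from the recurrences for `χ`: its `2`-kernel lies in the finite set
`kernelBound`, and `n ↦ χ ⌊n / 2⌋` is the characteristic sequence of `S₁`.
-/

namespace BinaryPartition

/-! ### Ternary quadratic forms of determinant one -/

/-- An integral ternary quadratic form
`a x² + b y² + c z² + 2 r y z + 2 s x z + 2 t x y`, with even cross coefficients. -/
structure TernaryForm where
  /-- coefficient of `x²` -/
  a : ℤ
  /-- coefficient of `y²` -/
  b : ℤ
  /-- coefficient of `z²` -/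
  c : ℤ
  /-- half the coefficient of `y z` -/
  r : ℤ
  /-- half the coefficient of `x z` -/
  s : ℤ
  /-- half the coefficient of `x y` -/
  t : ℤ

namespace TernaryForm

/-- The value of a ternary form at an integer vector. -/
def eval (F : TernaryForm) (x y z : ℤ) : ℤ :=
  F.a * x ^ 2 + F.b * y ^ 2 + F.c * z ^ 2 + 2 * F.r * y * z + 2 * F.s * x * z + 2 * F.t * x * y

/-- The determinant of the Gram matrix. -/
def det (F : TernaryForm) : ℤ :=
  F.a * F.b * F.c + 2 * F.r * F.s * F.t - F.a * F.r ^ 2 - F.b * F.s ^ 2 - F.c * F.t ^ 2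

/-- The leading `2 × 2` principal minor of the Gram matrix. Completing the square gives
`a F = (a x + t y + s z)² + g y² + 2 h y z + k z²`, and `minor` is the coefficient `g`. -/
def minor (F : TernaryForm) : ℤ := F.a * F.b - F.t ^ 2

/-- The coefficient `h` in `a F = (a x + t y + s z)² + g y² + 2 h y z + k z²`. -/
def mixedMinor (F : TernaryForm) : ℤ := F.a * F.r - F.s * F.t

/-- The form `F` in the variables `x, y + m z, z`. -/
def shiftYZ (F : TernaryForm) (m : ℤ) : TernaryForm :=
  ⟨F.a, F.b, F.c + 2 * F.r * m + F.b * m ^ 2, F.r + F.b * m, F.s + F.t * m, F.t⟩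

/-- The form `F` in the variables `x + m y, y, z`. -/
def shiftXY (F : TernaryForm) (m : ℤ) : TernaryForm :=
  ⟨F.a, F.b + 2 * F.t * m + F.a * m ^ 2, F.c, F.r + F.s * m, F.s, F.t + F.a * m⟩

theorem exists_centered_residue {g : ℤ} (hg : 0 < g) (h : ℤ) :
    ∃ m : ℤ, -g ≤ 2 * (h + g * m) ∧ 2 * (h + g * m) ≤ g := by
  refine ⟨-((2 * h + g) / (2 * g)), ?_⟩
  have h1 := Int.emod_add_mul_ediv (2 * h + g) (2 * g)
  have h2 := Int.emod_nonneg (2 * h + g) (show 2 * g ≠ 0 by omega)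
  have h3 := Int.emod_lt_of_pos (2 * h + g) (show 0 < 2 * g by omega)
  constructor <;> nlinarith

/-- The two shifts make `h` and `t` small, without changing `a` and the leading minor. -/
theorem exists_reduced (F : TernaryForm) (ha : 0 < F.a) (hg : 0 < F.minor) :
    ∃ F' : TernaryForm, F'.a = F.a ∧ F'.minor = F.minor ∧ F'.det = F.det ∧
      (-F.minor ≤ 2 * F'.mixedMinor ∧ 2 * F'.mixedMinor ≤ F.minor) ∧
      (-F.a ≤ 2 * F'.t ∧ 2 * F'.t ≤ F.a) ∧
      ∀ x y z, ∃ x' y' z', F.eval x y z = F'.eval x' y' z' := by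
  obtain ⟨m, hm⟩ := exists_centered_residue hg F.mixedMinor
  obtain ⟨l, hl⟩ := exists_centered_residue ha F.t
  have key : ((F.shiftYZ m).shiftXY l).mixedMinor = F.mixedMinor + F.minor * m := by
    simp only [shiftYZ, shiftXY, minor, mixedMinor]; ring
  refine ⟨(F.shiftYZ m).shiftXY l, rfl, ?_, ?_, by rwa [key], hl, fun x y z =>
    ⟨x - l * (y - m * z), y - m * z, z, ?_⟩⟩ <;>
  simp only [shiftYZ, shiftXY, minor, det, eval] <;> ring

/-- Descent on the pair `(a, minor)`, ordered lexicographically. After reduction, either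
exchanging `y` and `z` lowers the minor, or exchanging `x` and `y` lowers `a`, or the form
is `(x + s z)² + y² + z²`. -/
theorem isSumThreeSquares_eval (F : TernaryForm) (ha : 0 < F.a) (hg : 0 < F.minor)
    (hd : F.det = 1) (x y z : ℤ) : IsSumThreeSquares (F.eval x y z) := by
  obtain ⟨F', ha', hg', hd', hh, ht, hev⟩ := F.exists_reduced ha hg
  obtain ⟨u, v, w, hw⟩ := hev x y z
  rw [hw]
  have hgk : F'.minor * (F'.a * F'.c - F'.s ^ 2) = F'.a + F'.mixedMinor ^ 2 := by
    have : F'.minor * (F'.a * F'.c - F'.s ^ 2) = F'.a * F'.det + F'.mixedMinor ^ 2 := by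
      simp only [minor, mixedMinor, det]; ring
    rw [this, hd', hd, mul_one]
  have hgb : F'.a * F'.b = F'.minor + F'.t ^ 2 := by simp only [minor]; ring
  rw [← hg'] at hh
  rw [← ha'] at ht
  have ha0 : 0 < F'.a := ha' ▸ ha
  have hg0 : 0 < F'.minor := hg' ▸ hg
  have hh2 : 4 * F'.mixedMinor ^ 2 ≤ F'.minor ^ 2 := by nlinarith
  have ht2 : 4 * F'.t ^ 2 ≤ F'.a ^ 2 := by nlinarith
  have hk0 : 0 < F'.a * F'.c - F'.s ^ 2 :=
    pos_of_mul_pos_right (by rw [hgk]; positivity) hg0.le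
  have hb0 : 0 < F'.b := pos_of_mul_pos_right (by rw [hgb]; positivity) ha0.le
  by_cases hk : F'.a * F'.c - F'.s ^ 2 < F'.minor
  · have := isSumThreeSquares_eval ⟨F'.a, F'.c, F'.b, F'.r, F'.t, F'.s⟩ ha0 hk0
      (by rw [← hd, ← hd']; simp only [det]; ring) u w v
    convert this using 1
    simp only [eval]; ring
  have hg3 : 3 * F'.minor ^ 2 ≤ 4 * F'.a := by nlinarith
  by_cases hb : F'.b < F'.a
  · have := isSumThreeSquares_eval ⟨F'.b, F'.a, F'.c, F'.s, F'.r, F'.t⟩ hb0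
      (by change 0 < F'.b * F'.a - F'.t ^ 2; rw [mul_comm]; exact hg0)
      (by rw [← hd, ← hd']; simp only [det]; ring) v u w
    convert this using 1
    simp only [eval]; ring
  have h3a : 3 * F'.a ^ 2 ≤ 4 * F'.minor := by nlinarith
  have ha1 : F'.a = 1 := by
    by_contra hne
    have h2 : 2 ≤ F'.a := by omega
    have : 3 * F'.a ≤ 2 * F'.minor := by nlinarith
    nlinarith
  have hg1 : F'.minor = 1 := by
    rw [ha1] at hg3
    nlinarith
  have ht0 : F'.t = 0 := by omega
  have hb1 : F'.b = 1 := by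
    rw [ha1, ht0, hg1] at hgb
    linarith
  have hr0 : F'.r = 0 := by
    have : F'.mixedMinor = 0 := by omega
    simpa [mixedMinor, ha1, ht0] using this
  have hc : F'.c = 1 + F'.s ^ 2 := by
    have h := hd'.trans hd
    simp only [det, ha1, ht0, hb1, hr0] at h
    linarith
  refine ⟨u + F'.s * w, v, w, ?_⟩
  simp only [eval, ha1, ht0, hb1, hr0, hc]
  ring
termination_by (F.a.toNat, F.minor.toNat)
decreasing_by
  · rw [ha', Prod.lex_def]
    right
    refine ⟨rfl, ?_⟩
    change (F.a * F'.c - F'.s ^ 2).toNat < F.minor.toNat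
    rw [← ha']
    omega
  · rw [Prod.lex_def]
    left
    change F'.b.toNat < _
    omega

end TernaryForm

/-! ### The three-square theorem -/

/-- With `x² + d = a (d n - 1)`, the form with Gram matrix `(a, x, 1; x, d n - 1, 0; 1, 0, n)` is
positive definite of determinant one, and it takes the value `n` at `(0, 0, 1)`. -/
theorem isSumThreeSquares_of_dvd_sq_add {n d x : ℤ} (hd : 0 < d) (hn : 1 < d * n)
    (h : d * n - 1 ∣ x ^ 2 + d) : IsSumThreeSquares n := by
  obtain ⟨a, ha⟩ := h
  have h1 : 0 < d * n - 1 := by linarith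
  have ha0 : 0 < a := pos_of_mul_pos_right (by rw [← ha]; positivity) h1.le
  have := TernaryForm.isSumThreeSquares_eval ⟨a, d * n - 1, n, 0, 1, x⟩ ha0
    (by simp only [TernaryForm.minor]; linarith)
    (by simp only [TernaryForm.det]; linear_combination -n * ha) 0 0 1
  simpa [TernaryForm.eval] using this

open NumberTheorySymbols

theorem exists_dvd_sq_add_of_jacobiSym {p : ℕ} (hp : p.Prime) {d : ℤ} (h : J(-d | p) = 1) :
    ∃ x : ℤ, (p : ℤ) ∣ x ^ 2 + d := by
  have := Fact.mk hp
  obtain ⟨y, hy⟩ := ZMod.isSquare_of_jacobiSym_eq_one h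
  refine ⟨(y.val : ℤ), ?_⟩
  rw [← ZMod.intCast_zmod_eq_zero_iff_dvd]
  push_cast at hy ⊢
  rw [ZMod.natCast_zmod_val, pow_two, ← hy]
  ring

/-- For `n ≡ 2` modulo `4`, a prime `p = d n - 1` with `d = 4 j + 1` is used. Then `p ≡ 1` modulo
`4`, so reciprocity gives `(-d / p) = (p / d) = (-1 / d) = 1`. -/
theorem isSumThreeSquares_of_mod_four_eq_two {n : ℕ} (hn : n % 4 = 2) :
    IsSumThreeSquares n := by
  have hcop : Nat.Coprime (n - 1) (4 * n) := by
    apply Nat.Coprime.mul_right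
    · have : Odd (n - 1) := Nat.odd_iff.2 (by omega)
      exact (this.coprime_two_right.pow_right 2 :)
    · have := (Nat.coprime_self_add_right (m := n - 1) (n := 1)).2 (by simp)
      rwa [Nat.sub_add_cancel (by omega)] at this
  obtain ⟨p, hpn, hp, hmod⟩ :=
    Nat.forall_exists_prime_gt_and_modEq n (by omega : 4 * n ≠ 0) hcop
  obtain ⟨j, hj⟩ := (Nat.modEq_iff_dvd' (by omega)).1 hmod.symm
  have hpj : p + 1 = (4 * j + 1) * n := by
    have : p = 4 * n * j + (n - 1) := by omega
    rw [this, add_assoc, Nat.sub_add_cancel (by omega)]; ring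
  set d := 4 * j + 1 with hd
  have hp4 : p % 4 = 1 := by
    have : (p + 1) % 4 = 2 := by rw [hpj, Nat.mul_mod, hn, hd]; omega
    omega
  have hdodd : Odd d := Nat.odd_iff.2 (by omega)
  have hpodd : Odd p := Nat.odd_iff.2 (by omega)
  have hJ : J(-(d : ℤ) | p) = 1 := by
    rw [jacobiSym.neg _ hpodd, ZMod.χ₄_nat_one_mod_four hp4, one_mul,
      jacobiSym.quadratic_reciprocity_one_mod_four' hdodd hp4,
      jacobiSym.mod_left' (a₂ := -1), jacobiSym.at_neg_one hdodd,
      ZMod.χ₄_nat_one_mod_four (by omega)]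
    refine Int.modEq_iff_dvd.2 ⟨-n, ?_⟩
    have : ((p + 1 : ℕ) : ℤ) = d * n := by rw [hpj]; push_cast; rfl
    push_cast at this
    linarith
  obtain ⟨x, hx⟩ := exists_dvd_sq_add_of_jacobiSym hp hJ
  have hpe : (d : ℤ) * n - 1 = p := by
    have : ((p + 1 : ℕ) : ℤ) = d * n := by rw [hpj]; push_cast; rfl
    push_cast at this; linarith
  refine isSumThreeSquares_of_dvd_sq_add (d := d) (x := x) (by omega) ?_ (by rwa [hpe])
  have := hp.two_le
  omega

/-- For odd `n`, a prime `p` with `2 p = d n - 1` and `d` congruent to `c` modulo `8` is used.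
The class of `d` modulo `8` gives `(-2 / d) = 1`, whence `(p / d) = 1`, and `-d` is a square
modulo `p` by reciprocity. -/
theorem isSumThreeSquares_of_two_mul_add_one {n c q : ℕ} (hn : 1 < n) (hq : 2 * q + 1 = c * n)
    (hqodd : q % 2 = 1) (hc : c = 3 ∨ c = 1 ∧ q % 4 = 1) : IsSumThreeSquares n := by
  have hcop : Nat.Coprime q (4 * n) := by
    apply Nat.Coprime.mul_right
    · exact ((Nat.odd_iff.2 hqodd).coprime_two_right.pow_right 2 :)
    · have h : Nat.Coprime q (c * n) := by rw [← hq]; simp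
      exact h.coprime_mul_left_right
  obtain ⟨p, hpn, hp, hmod⟩ :=
    Nat.forall_exists_prime_gt_and_modEq (q + 2) (by omega : 4 * n ≠ 0) hcop
  obtain ⟨j, hj⟩ := (Nat.modEq_iff_dvd' (by omega)).1 hmod.symm
  obtain ⟨d, hd⟩ : ∃ d, d = 8 * j + c := ⟨_, rfl⟩
  have hpj : 2 * p + 1 = d * n := by
    have : p = 4 * n * j + q := by omega
    rw [this, hd, add_mul, ← hq]; ring
  have hpq : p % 4 = q % 4 := by
    have : p = 4 * (n * j) + q := by rw [← mul_assoc]; omega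
    omega
  have hdodd : Odd d := Nat.odd_iff.2 (by omega)
  have hpodd : Odd p := Nat.odd_iff.2 (by omega)
  have hpe : (d : ℤ) * n - 1 = 2 * p := by
    have : ((2 * p + 1 : ℕ) : ℤ) = d * n := by rw [hpj]; push_cast; rfl
    push_cast at this; linarith
  have hpd : J(p | d) = 1 := by
    have h2 : J(-2 | d) = 1 := by
      rw [jacobiSym.at_neg_two hdodd, ZMod.χ₈'_nat_eq_if_mod_eight,
        if_neg (by omega), if_pos (by omega)]
    have h1 : J(-2 * p | d) = 1 := by
      rw [jacobiSym.mod_left' (a₂ := 1), jacobiSym.one_left]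
      exact Int.modEq_iff_dvd.2 ⟨n, by linarith⟩
    rwa [jacobiSym.mul_left, h2, one_mul] at h1
  have hJ : J(-(d : ℤ) | p) = 1 := by
    rw [jacobiSym.neg _ hpodd]
    rcases (by omega : p % 4 = 1 ∨ p % 4 = 3 ∧ d % 4 = 3) with h | ⟨h, h'⟩
    · rw [ZMod.χ₄_nat_one_mod_four h, jacobiSym.quadratic_reciprocity_one_mod_four' hdodd h,
        hpd, one_mul]
    · rw [ZMod.χ₄_nat_three_mod_four h, jacobiSym.quadratic_reciprocity_three_mod_four h' h, hpd]
      norm_num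
  obtain ⟨x, hx⟩ := exists_dvd_sq_add_of_jacobiSym hp hJ
  -- Adding `p` if necessary makes the square root of `-d` odd.
  obtain ⟨y, hy, hyodd⟩ : ∃ y : ℤ, (p : ℤ) ∣ y ^ 2 + d ∧ Odd y := by
    rcases Int.even_or_odd x with hx' | hx'
    · refine ⟨x + p, ?_, hx'.add_odd (by exact_mod_cast hpodd)⟩
      have : (x + p) ^ 2 + d = x ^ 2 + d + p * (2 * x + p) := by ring
      rw [this]
      exact dvd_add hx (dvd_mul_right _ _)
    · exact ⟨x, hx, hx'⟩
  have h2 : (2 : ℤ) ∣ y ^ 2 + d :=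
    ((hyodd.pow).add_odd (by exact_mod_cast hdodd : Odd (d : ℤ))).two_dvd
  have hcop2 : IsCoprime (2 : ℤ) p := by
    exact_mod_cast Nat.isCoprime_iff_coprime.2 hpodd.coprime_two_left
  refine isSumThreeSquares_of_dvd_sq_add (d := d) (x := y) (by omega) ?_ ?_
  · have := hp.two_le
    omega
  · rw [hpe]
    exact hcop2.mul_dvd h2 hy

/-- The cases of Legendre's three-square theorem with `n` not divisible by `4`. -/
theorem isSumThreeSquares_of_mod_eight {n : ℕ} (h4 : n % 4 ≠ 0) (h8 : n % 8 ≠ 7) :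
    IsSumThreeSquares n := by
  by_cases h1 : n = 1
  · exact ⟨1, 0, 0, by simp [h1]⟩
  rcases (by omega : n % 4 = 2 ∨ n % 4 = 1 ∨ n % 8 = 3) with h | h | h
  · exact isSumThreeSquares_of_mod_four_eq_two h
  · exact isSumThreeSquares_of_two_mul_add_one (c := 3) (q := (3 * n - 1) / 2)
      (by omega) (by omega) (by omega) (by omega)
  · exact isSumThreeSquares_of_two_mul_add_one (c := 1) (q := (n - 1) / 2)
      (by omega) (by omega) (by omega) (by omega)

theorem IsSumThreeSquares.four_mul {m : ℤ} (h : IsSumThreeSquares m) :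
    IsSumThreeSquares (4 * m) := by
  obtain ⟨x, y, z, rfl⟩ := h
  exact ⟨2 * x, 2 * y, 2 * z, by ring⟩

theorem not_isSumThreeSquares_of_emod_thirtyTwo {m : ℤ} (h : m % 32 = 28) :
    ¬ IsSumThreeSquares m := by
  rintro ⟨x, y, z, hm⟩
  have even_or : ∀ x : ℤ, (∃ u, x = 2 * u) ∨ (∃ u, x ^ 2 = 4 * u + 1) := fun x => by
    rcases Int.even_or_odd' x with ⟨k, rfl | rfl⟩
    · exact Or.inl ⟨k, rfl⟩
    · exact Or.inr ⟨k ^ 2 + k, by ring⟩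
  have sq_eight : ∀ x : ℤ, x ^ 2 % 8 = 0 ∨ x ^ 2 % 8 = 1 ∨ x ^ 2 % 8 = 4 := fun x => by
    rcases (by omega : x % 8 = 0 ∨ x % 8 = 1 ∨ x % 8 = 2 ∨ x % 8 = 3 ∨ x % 8 = 4 ∨ x % 8 = 5 ∨
      x % 8 = 6 ∨ x % 8 = 7) with h | h | h | h | h | h | h | h <;> simp [pow_two, Int.mul_emod, h]
  -- The sum is divisible by `4`, so all three squares are even.
  obtain ⟨u, rfl⟩ : ∃ u, x = 2 * u := (even_or x).resolve_right fun ⟨u, hu⟩ => by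
    have := sq_eight y; have := sq_eight z; omega
  obtain ⟨v, rfl⟩ : ∃ v, y = 2 * v := (even_or y).resolve_right fun ⟨v, hv⟩ => by
    have := sq_eight (2 * u); have := sq_eight z; omega
  obtain ⟨w, rfl⟩ : ∃ w, z = 2 * w := (even_or z).resolve_right fun ⟨w, hw⟩ => by
    have := sq_eight (2 * u); have := sq_eight (2 * v); omega
  have := sq_eight u
  have := sq_eight v
  have := sq_eight w
  have : m = 4 * (u ^ 2 + v ^ 2 + w ^ 2) := by rw [hm]; ring
  omega


/-! ### The recurrence for binary partitions -/

/-- The multisets of powers of two with sum `n`. -/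
def powMultisets (n : ℕ) : Set (Multiset ℕ) :=
  {m | (∀ i ∈ m, Nat.isPowerOfTwo i) ∧ m.sum = n}

theorem image_parts_restricted (n : ℕ) :
    Nat.Partition.parts '' (Nat.Partition.restricted n Nat.isPowerOfTwo : Set n.Partition) =
      powMultisets n := by
  ext m
  simp only [Set.mem_image, Finset.mem_coe, Nat.Partition.restricted, Finset.mem_filter,
    Finset.mem_univ, true_and, powMultisets]
  constructor
  · rintro ⟨p, hp, rfl⟩
    exact ⟨hp, p.parts_sum⟩
  · rintro ⟨h1, h2⟩
    exact ⟨⟨m, fun hi => Nat.pos_of_isPowerOfTwo (h1 _ hi), h2⟩, h1, rfl⟩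

theorem finite_powMultisets (n : ℕ) : (powMultisets n).Finite := by
  rw [← image_parts_restricted]
  exact (Finset.finite_toSet _).image _

theorem b_eq_ncard (n : ℕ) : b n = (powMultisets n).ncard := by
  rw [← image_parts_restricted, Set.ncard_image_of_injective _ fun p q h => Nat.Partition.ext h,
    Set.ncard_coe_finset, b]

theorem isPowerOfTwo_two_mul_iff {i : ℕ} : Nat.isPowerOfTwo (2 * i) ↔ Nat.isPowerOfTwo i := by
  constructor
  · rintro ⟨k, hk⟩
    rcases k with _ | k
    · omega
    · exact ⟨k, by rw [pow_succ] at hk; omega⟩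
  · rintro ⟨k, rfl⟩
    exact ⟨k + 1, by rw [pow_succ]; omega⟩

theorem eq_one_or_two_mul {i : ℕ} (h : Nat.isPowerOfTwo i) : i = 1 ∨ ∃ j, i = 2 * j := by
  obtain ⟨k, rfl⟩ := h
  rcases k with _ | k
  · exact Or.inl rfl
  · exact Or.inr ⟨2 ^ k, by rw [pow_succ]; omega⟩

theorem cons_one_mem_powMultisets {n : ℕ} {m : Multiset ℕ} :
    1 ::ₘ m ∈ powMultisets (n + 1) ↔ m ∈ powMultisets n := by
  simp only [powMultisets, Set.mem_ofPred_eq, Multiset.mem_cons, forall_eq_or_imp,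
    Multiset.sum_cons]
  have : Nat.isPowerOfTwo 1 := Nat.isPowerOfTwo_one
  constructor
  · rintro ⟨⟨-, h⟩, h'⟩; exact ⟨h, by omega⟩
  · rintro ⟨h, h'⟩; exact ⟨⟨this, h⟩, by omega⟩

theorem map_two_mul_mem_powMultisets {n : ℕ} {m : Multiset ℕ} :
    m.map (2 * ·) ∈ powMultisets (2 * n) ↔ m ∈ powMultisets n := by
  simp only [powMultisets, Set.mem_ofPred_eq, Multiset.mem_map, forall_exists_index, and_imp,
    forall_apply_eq_imp_iff₂, isPowerOfTwo_two_mul_iff]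
  rw [Multiset.sum_map_mul_left, Multiset.map_id']
  simp

theorem exists_map_two_mul {n : ℕ} {m : Multiset ℕ} (hm : m ∈ powMultisets n) (h1 : 1 ∉ m) :
    ∃ m' : Multiset ℕ, m = m'.map (2 * ·) := by
  refine ⟨m.map (· / 2), ?_⟩
  rw [Multiset.map_map]
  conv_lhs => rw [← Multiset.map_id m]
  refine Multiset.map_congr rfl fun i hi => ?_
  rcases eq_one_or_two_mul (hm.1 i hi) with rfl | ⟨j, rfl⟩
  · exact absurd hi h1
  · simp

theorem powMultisets_odd (n : ℕ) :
    powMultisets (2 * n + 1) = (1 ::ₘ ·) '' powMultisets (2 * n) := by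
  ext m
  constructor
  · intro hm
    by_cases h1 : 1 ∈ m
    · obtain ⟨m', rfl⟩ := Multiset.exists_cons_of_mem h1
      exact ⟨m', cons_one_mem_powMultisets.1 hm, rfl⟩
    · obtain ⟨m', rfl⟩ := exists_map_two_mul hm h1
      have := hm.2
      rw [Multiset.sum_map_mul_left] at this
      omega
  · rintro ⟨m', hm', rfl⟩
    exact cons_one_mem_powMultisets.2 hm'

theorem powMultisets_even (n : ℕ) :
    powMultisets (2 * n + 2) =
      (1 ::ₘ ·) '' powMultisets (2 * n + 1) ∪ Multiset.map (2 * ·) '' powMultisets (n + 1) := by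
  ext m
  constructor
  · intro hm
    by_cases h1 : 1 ∈ m
    · obtain ⟨m', rfl⟩ := Multiset.exists_cons_of_mem h1
      exact Or.inl ⟨m', cons_one_mem_powMultisets.1 hm, rfl⟩
    · obtain ⟨m', rfl⟩ := exists_map_two_mul hm h1
      exact Or.inr ⟨m', (map_two_mul_mem_powMultisets (n := n + 1)).1 hm, rfl⟩
  · rintro (⟨m', hm', rfl⟩ | ⟨m', hm', rfl⟩)
    · exact cons_one_mem_powMultisets.2 hm'
    · exact (map_two_mul_mem_powMultisets (n := n + 1)).2 hm'

theorem b_two_mul_add_one (n : ℕ) : b (2 * n + 1) = b (2 * n) := by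
  rw [b_eq_ncard, b_eq_ncard, powMultisets_odd,
    Set.ncard_image_of_injective _ fun _ _ => (Multiset.cons_inj_right 1).1]

theorem b_two_mul_add_two (n : ℕ) : b (2 * n + 2) = b (2 * n) + b (n + 1) := by
  rw [b_eq_ncard (2 * n + 2), powMultisets_even,
    Set.ncard_union_eq ?_ ((finite_powMultisets _).image _) ((finite_powMultisets _).image _),
    Set.ncard_image_of_injective _ fun _ _ => (Multiset.cons_inj_right 1).1,
    Set.ncard_image_of_injective _ (Multiset.map_injective (mul_right_injective₀ two_ne_zero)),
    ← b_eq_ncard, ← b_eq_ncard, b_two_mul_add_one]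
  · rw [Set.disjoint_left]
    rintro _ ⟨m, -, rfl⟩ ⟨m', -, h⟩
    have : 1 ∈ m'.map (2 * ·) := by
      rw [h]; exact Multiset.mem_cons_self _ _
    obtain ⟨j, -, hj⟩ := Multiset.mem_map.1 this
    omega

theorem b_zero : b 0 = 1 := by
  have : powMultisets 0 = {0} := by
    ext m
    simp only [Set.mem_singleton_iff]
    constructor
    · rintro ⟨h1, h2⟩
      refine Multiset.eq_zero_of_forall_notMem fun i hi => ?_
      have h3 := Multiset.sum_eq_zero_iff.1 h2 i hi
      have h4 := Nat.pos_of_isPowerOfTwo (h1 i hi)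
      omega
    · rintro rfl
      exact ⟨by simp, by simp⟩
  rw [b_eq_ncard, this, Set.ncard_singleton]


/-! ### Congruences for binary partitions -/

/-- The sequence `n ↦ b (2 n)`. Its value at `n > 0` is the sum of its values at `n - 1` and
`⌊n / 2⌋` (`bEven_odd` and `bEven_even`, with the arguments up to equality for use with `omega`). -/
def bEven (n : ℕ) : ℕ := b (2 * n)

theorem bEven_zero : bEven 0 = 1 := b_zero

theorem bEven_odd {k m n : ℕ} (hk : k = 2 * n + 1) (hm : m = 2 * n) :
    bEven k = bEven m + bEven n := by
  subst hk hm
  have h := b_two_mul_add_two (2 * n)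
  rw [b_two_mul_add_one] at h
  exact h

theorem bEven_even {k m n : ℕ} (hk : k = 2 * n) (hm : k = m + 1) :
    bEven k = bEven m + bEven n := by
  subst hm
  have h := b_two_mul_add_two m
  rw [hk] at h
  exact h

theorem bEven_mod_two {n : ℕ} (hn : 0 < n) : bEven n % 2 = 0 := by
  induction n using Nat.strong_induction_on with
  | _ n ih =>
    have h0 := bEven_zero
    rcases Nat.even_or_odd' n with ⟨m, rfl | rfl⟩
    · have h1 := bEven_even (k := 2 * m) (m := 2 * m - 1) rfl (by omega)
      have h2 := ih (2 * m - 1) (by omega) (by omega)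
      have h3 := ih m (by omega) (by omega)
      omega
    · have h1 := bEven_odd (k := 2 * m + 1) rfl rfl
      rcases Nat.eq_zero_or_pos m with rfl | hm
      · simp only [mul_zero] at *
        omega
      · have h2 := ih (2 * m) (by omega) (by omega)
        have h3 := ih m (by omega) (by omega)
        omega

theorem bEven_four_mul_add_two (n : ℕ) :
    bEven (4 * n + 2) = bEven (4 * n) + 2 * bEven (2 * n) + bEven n := by
  have h1 := bEven_odd (k := 4 * n + 1) (m := 4 * n) (n := 2 * n) (by omega) (by omega)
  have h2 := bEven_even (k := 4 * n + 2) (m := 4 * n + 1) (n := 2 * n + 1) (by omega) (by omega)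
  have h3 := bEven_odd (k := 2 * n + 1) rfl rfl
  omega

theorem bEven_four_mul_add_four (n : ℕ) :
    bEven (4 * n + 4) = bEven (4 * n) + 4 * bEven (2 * n) + 3 * bEven n + bEven (n + 1) := by
  have h1 := bEven_four_mul_add_two n
  have h2 := bEven_odd (k := 4 * n + 3) (m := 4 * n + 2) (n := 2 * n + 1) (by omega) (by omega)
  have h3 := bEven_even (k := 4 * n + 4) (m := 4 * n + 3) (n := 2 * n + 2) (by omega) (by omega)
  have h4 := bEven_odd (k := 2 * n + 1) rfl rfl
  have h5 := bEven_even (k := 2 * n + 2) (m := 2 * n + 1) (n := n + 1) (by omega) (by omega)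
  omega

theorem bEven_eight_mul_add_four (n : ℕ) :
    bEven (8 * n + 4) = bEven (8 * n) + 4 * bEven (4 * n) + 4 * bEven (2 * n) + bEven n := by
  have h1 := bEven_four_mul_add_four (2 * n)
  have h2 := bEven_odd (k := 2 * n + 1) rfl rfl
  rw [← mul_assoc, ← mul_assoc] at h1
  norm_num at h1
  omega

theorem bEven_four_mul_modEq (n : ℕ) : bEven (4 * n) ≡ bEven n [MOD 8] := by
  induction n with
  | zero => rfl
  | succ n ih =>
    have h := bEven_four_mul_add_four n
    have h0 := bEven_zero
    unfold Nat.ModEq at *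
    rcases Nat.eq_zero_or_pos n with rfl | hn
    · norm_num at *
      omega
    · have h1 := bEven_mod_two hn
      have h2 := bEven_mod_two (n := 2 * n) (by omega)
      rw [mul_add, mul_one]
      omega

theorem bEven_four_mul_add_two_mod_four (n : ℕ) : bEven (4 * n + 2) % 4 = 0 := by
  have h := bEven_four_mul_add_two n
  have h0 := bEven_zero
  rcases Nat.eq_zero_or_pos n with rfl | hn
  · norm_num at *
    omega
  · have h1 := bEven_mod_two hn
    have h2 := bEven_mod_two (n := 2 * n) (by omega)
    have h3 := bEven_four_mul_modEq n
    unfold Nat.ModEq at h3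
    omega

/-- The increments of the two sides differ by `8 * bEven (4 n + 2)`, a multiple of `32`. -/
theorem bEven_eight_mul_modEq (n : ℕ) : bEven (8 * n) ≡ bEven (2 * n) [MOD 32] := by
  induction n with
  | zero => rfl
  | succ n ih =>
    have h1 := bEven_four_mul_add_four (2 * n + 1)
    have h2 := bEven_eight_mul_add_four n
    have h3 := bEven_four_mul_add_two n
    have h4 := bEven_four_mul_add_two_mod_four n
    have h5 := bEven_odd (k := 2 * n + 1) rfl rfl
    have h6 := bEven_even (k := 2 * n + 2) (m := 2 * n + 1) (n := n + 1) (by omega) (by omega)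
    have e1 : 4 * (2 * n + 1) = 8 * n + 4 := by ring
    have e2 : 2 * (2 * n + 1) = 4 * n + 2 := by ring
    rw [e1, e2] at h1
    norm_num [add_assoc] at h1 h6
    unfold Nat.ModEq at *
    rw [mul_add, mul_add]
    norm_num
    omega

theorem s₂_two_mul (n : ℕ) : s₂ (2 * n) = s₂ n := by
  rcases Nat.eq_zero_or_pos n with rfl | hn
  · rfl
  · rw [s₂, Nat.digits_def' (by norm_num) (by omega)]
    simp [s₂]

theorem s₂_two_mul_add_one (n : ℕ) : s₂ (2 * n + 1) = s₂ n + 1 := by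
  rw [s₂, Nat.digits_def' (by norm_num) (by omega), List.sum_cons, s₂]
  have h1 : (2 * n + 1) % 2 = 1 := by omega
  have h2 : (2 * n + 1) / 2 = n := by omega
  rw [h1, h2, add_comm]

theorem t_zero : t 0 = 1 := by simp [t, s₂]

theorem t_two_mul (n : ℕ) : t (2 * n) = t n := by rw [t, s₂_two_mul, t]

theorem t_two_mul_add_one (n : ℕ) : t (2 * n + 1) = -t n := by
  rw [t, s₂_two_mul_add_one, pow_succ, t]; ring

theorem t_eq_one_or (n : ℕ) : t n = 1 ∧ T n = 0 ∨ t n = -1 ∧ T n = 1 := by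
  unfold t T
  rcases Nat.even_or_odd (s₂ n) with h | h
  · exact Or.inl ⟨h.neg_one_pow, Nat.even_iff.1 h⟩
  · exact Or.inr ⟨h.neg_one_pow, Nat.odd_iff.1 h⟩

/-- The sign of the Thue–Morse sequence enters here: modulo `16`, the left side is unchanged
under `n ↦ 2 n` and changes sign under `n ↦ 2 n + 1`. -/
theorem bEven_four_mul_add_bEven_two_mul (n : ℕ) :
    ((bEven (4 * n) + bEven (2 * n) : ℕ) : ℤ) ≡ 2 * t n [ZMOD 16] := by
  induction n using Nat.strong_induction_on with
  | _ n ih =>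
    have h0 := bEven_zero
    have ht0 := t_zero
    rcases Nat.even_or_odd' n with ⟨m, rfl | rfl⟩
    · have h1 := bEven_eight_mul_modEq m
      rw [t_two_mul, ← mul_assoc, ← mul_assoc]
      norm_num
      rcases Nat.eq_zero_or_pos m with rfl | hm
      · norm_num [h0, ht0]
      · have h2 := ih m (by omega)
        unfold Nat.ModEq Int.ModEq at *
        omega
    · have h1 := bEven_eight_mul_modEq m
      have h2 := ih m (by omega)
      have h3 := bEven_eight_mul_add_four m
      have h4 := bEven_four_mul_add_two m
      have h5 := bEven_four_mul_modEq m
      have e1 : 4 * (2 * m + 1) = 8 * m + 4 := by ring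
      have e2 : 2 * (2 * m + 1) = 4 * m + 2 := by ring
      rw [t_two_mul_add_one, e1, e2]
      unfold Nat.ModEq Int.ModEq at *
      rcases Nat.eq_zero_or_pos m with rfl | hm
      · clear ih
        simp only [mul_zero, zero_add] at *
        omega
      · have h6 := bEven_mod_two hm
        have h7 := bEven_mod_two (n := 2 * m) (by omega)
        omega

theorem bEven_two_mul_add_one_modEq (n : ℕ) :
    (bEven (2 * n + 1) : ℤ) ≡ 2 * t n [ZMOD 8] := by
  have h1 := bEven_four_mul_add_bEven_two_mul n
  have h2 := bEven_four_mul_modEq n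
  have h3 := bEven_odd (k := 2 * n + 1) rfl rfl
  unfold Nat.ModEq Int.ModEq at *
  omega

theorem bEven_eight_mul_add_two_modEq (n : ℕ) :
    (bEven (8 * n + 2) : ℤ) ≡ 4 * t n [ZMOD 32] := by
  have h1 := bEven_four_mul_add_bEven_two_mul n
  have h2 := bEven_eight_mul_modEq n
  have h3 := bEven_four_mul_add_two (2 * n)
  rw [← mul_assoc, ← mul_assoc] at h3
  norm_num at h3
  unfold Nat.ModEq Int.ModEq at *
  omega

theorem bEven_eight_mul_add_six_modEq (n : ℕ) :
    (bEven (8 * n + 6) : ℤ) ≡ 20 * t n [ZMOD 32] := by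
  have h1 := bEven_four_mul_add_bEven_two_mul n
  have h2 := bEven_eight_mul_modEq n
  have h3 := bEven_four_mul_add_two (2 * n + 1)
  have h4 := bEven_eight_mul_add_four n
  have h5 := bEven_four_mul_add_two n
  have h6 := bEven_odd (k := 2 * n + 1) rfl rfl
  have h7 := bEven_two_mul_add_one_modEq n
  have e1 : 4 * (2 * n + 1) = 8 * n + 4 := by ring
  have e2 : 2 * (2 * n + 1) = 4 * n + 2 := by ring
  rw [e1, e2] at h3
  norm_num [add_assoc] at h3
  unfold Nat.ModEq Int.ModEq at *
  omega

/-- The residues of `b (2 n)`, for `n > 0`. Passing from `n` to `4 n` keeps the residue modulo `8`,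
and modulo `32` when `n` is even. -/
theorem bEven_residue_cases {n : ℕ} (hn : 0 < n) :
    (χ n = 0 ∧ (bEven n % 8 = 2 ∨ bEven n % 8 = 6)) ∨
    (n % 2 = 0 ∧ χ n = 0 ∧ (bEven n % 32 = 4 ∨ bEven n % 32 = 12 ∨ bEven n % 32 = 20)) ∨
    (n % 2 = 0 ∧ χ n = 1 ∧ bEven n % 32 = 28) := by
  induction n using Nat.strong_induction_on with
  | _ n ih =>
    rcases (by omega : n % 2 = 1 ∨ n % 4 = 0 ∨ n % 8 = 2 ∨ n % 8 = 6) with h | h | h | h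
    · obtain ⟨m, rfl⟩ : ∃ m, n = 2 * m + 1 := ⟨n / 2, by omega⟩
      have h1 := bEven_two_mul_add_one_modEq m
      have h2 := t_eq_one_or m
      have h3 := χ_two_mul_add_one m
      unfold Int.ModEq at h1
      omega
    · obtain ⟨m, rfl⟩ : ∃ m, n = 4 * m := ⟨n / 4, by omega⟩
      have h1 := ih m (by omega) (by omega)
      have h2 := bEven_four_mul_modEq m
      rw [χ_four_mul]
      rcases Nat.even_or_odd' m with ⟨l, rfl | rfl⟩
      · have h3 := bEven_eight_mul_modEq l
        have e : 4 * (2 * l) = 8 * l := by ring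
        rw [e] at *
        unfold Nat.ModEq at *
        omega
      · unfold Nat.ModEq at *
        omega
    · obtain ⟨m, rfl⟩ : ∃ m, n = 8 * m + 2 := ⟨n / 8, by omega⟩
      have h1 := bEven_eight_mul_add_two_modEq m
      have h2 := t_eq_one_or m
      have h3 := χ_eight_mul_add_two m
      unfold Int.ModEq at h1
      omega
    · obtain ⟨m, rfl⟩ : ∃ m, n = 8 * m + 6 := ⟨n / 8, by omega⟩
      have h1 := bEven_eight_mul_add_six_modEq m
      have h2 := t_eq_one_or m
      have h3 := χ_eight_mul_add_six m
      unfold Int.ModEq at h1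
      omega

theorem not_isSumThreeSquares_bEven_iff (n : ℕ) :
    ¬ IsSumThreeSquares (b (2 * n)) ↔ χ n = 1 := by
  change ¬ IsSumThreeSquares (bEven n) ↔ _
  rcases Nat.eq_zero_or_pos n with rfl | hn
  · rw [bEven_zero, χ_zero]
    have : IsSumThreeSquares 1 := ⟨1, 0, 0, by norm_num⟩
    simp [this]
  rcases bEven_residue_cases hn with ⟨h1, h2⟩ | ⟨-, h1, h2⟩ | ⟨-, h1, h2⟩
  · simpa [h1] using isSumThreeSquares_of_mod_eight (n := bEven n) (by omega) (by omega)
  · obtain ⟨r, hr⟩ : ∃ r, bEven n = 4 * r := ⟨bEven n / 4, by omega⟩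
    have h := (isSumThreeSquares_of_mod_eight (n := r) (by omega) (by omega)).four_mul
    simpa [h1, hr] using h
  · simpa [h1] using not_isSumThreeSquares_of_emod_thirtyTwo (m := bEven n) (by omega)

/-! ### Descriptions of the support of `χ` -/

theorem χ_eq_zero_or_one (n : ℕ) : χ n = 0 ∨ χ n = 1 := by
  rcases Nat.eq_zero_or_pos n with rfl | hn
  · exact Or.inl χ_zero
  · have := bEven_residue_cases hn
    omega

theorem χ_eq_one_iff_exists (n : ℕ) :
    χ n = 1 ↔ ∃ k s : ℕ, n = 2 ^ (2 * k + 1) * (4 * s + 1) ∧ t s = -1 := by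
  constructor
  · induction n using Nat.strong_induction_on with
    | _ n ih =>
      intro hχ
      rcases (by omega : n = 0 ∨ n % 2 = 1 ∨ (0 < n ∧ n % 4 = 0) ∨ n % 8 = 2 ∨ n % 8 = 6) with
        rfl | h | h | h | h
      · simp [χ_zero] at hχ
      · obtain ⟨m, rfl⟩ : ∃ m, n = 2 * m + 1 := ⟨n / 2, by omega⟩
        simp [χ_two_mul_add_one] at hχ
      · obtain ⟨m, rfl⟩ : ∃ m, n = 4 * m := ⟨n / 4, by omega⟩
        rw [χ_four_mul] at hχ
        obtain ⟨k, s, hm, hs⟩ := ih m (by omega) hχ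
        exact ⟨k + 1, s, by rw [hm]; ring, hs⟩
      · obtain ⟨m, rfl⟩ : ∃ m, n = 8 * m + 2 := ⟨n / 8, by omega⟩
        rw [χ_eight_mul_add_two] at hχ
        have := t_eq_one_or m
        exact ⟨0, m, by ring, by omega⟩
      · obtain ⟨m, rfl⟩ : ∃ m, n = 8 * m + 6 := ⟨n / 8, by omega⟩
        simp [χ_eight_mul_add_six] at hχ
  · rintro ⟨k, s, rfl, hs⟩
    induction k with
    | zero =>
      have e : 2 ^ (2 * 0 + 1) * (4 * s + 1) = 8 * s + 2 := by ring
      have := t_eq_one_or s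
      rw [e, χ_eight_mul_add_two]
      omega
    | succ k ih =>
      have e : 2 ^ (2 * (k + 1) + 1) * (4 * s + 1) = 4 * (2 ^ (2 * k + 1) * (4 * s + 1)) := by ring
      rw [e, χ_four_mul, ih]

/-- The indices `s` with `t s = -1` are the numbers `2 r + 1` with `t r = 1` and `2 r` with
`t r = -1`, which gives `4 s + 1 = 8 r + 2 t r + 3`. -/
theorem exists_t_eq_neg_one_iff (u : ℤ) :
    (∃ s : ℕ, u = 4 * s + 1 ∧ t s = -1) ↔ ∃ r : ℕ, u = 8 * (r : ℤ) + 2 * t r + 3 := by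
  constructor
  · rintro ⟨s, hu, hs⟩
    rcases Nat.even_or_odd' s with ⟨r, rfl | rfl⟩
    · rw [t_two_mul] at hs
      exact ⟨r, by push_cast at hu; omega⟩
    · rw [t_two_mul_add_one] at hs
      exact ⟨r, by push_cast at hu; omega⟩
  · rintro ⟨r, hu⟩
    rcases t_eq_one_or r with ⟨h, -⟩ | ⟨h, -⟩
    · exact ⟨2 * r + 1, by push_cast; omega, by rw [t_two_mul_add_one, h]⟩
    · exact ⟨2 * r, by push_cast; omega, by rw [t_two_mul, h]⟩

theorem χ_eq_one_iff_exists' (n : ℕ) :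
    χ n = 1 ↔ ∃ k r : ℕ, (n : ℤ) = 2 ^ (2 * k + 1) * (8 * (r : ℤ) + 2 * t r + 3) := by
  rw [χ_eq_one_iff_exists]
  refine exists_congr fun k => ⟨?_, ?_⟩
  · rintro ⟨s, rfl, hs⟩
    obtain ⟨r, hr⟩ := (exists_t_eq_neg_one_iff _).1 ⟨s, rfl, hs⟩
    exact ⟨r, by rw [← hr]; push_cast; ring⟩
  · rintro ⟨r, hr⟩
    obtain ⟨s, hs, hts⟩ := (exists_t_eq_neg_one_iff _).2 ⟨r, rfl⟩
    exact ⟨s, by rw [hs] at hr; exact_mod_cast hr, hts⟩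

theorem mem_S₁'_iff (n : ℕ) : n ∈ S₁' ↔ χ n = 1 := not_isSumThreeSquares_bEven_iff n

theorem mem_S₁_iff (n : ℕ) : n ∈ S₁ ↔ χ (n / 2) = 1 := by
  rw [← not_isSumThreeSquares_bEven_iff]
  change ¬ IsSumThreeSquares (b n) ↔ _
  rcases Nat.even_or_odd' n with ⟨m, rfl | rfl⟩
  · rw [Nat.mul_div_cancel_left m two_pos]
  · rw [b_two_mul_add_one, (by omega : (2 * m + 1) / 2 = m)]

theorem charSeq_S₁' : charSeq S₁' = χ := by
  classical
  funext n
  rw [charSeq, Set.indicator_apply]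
  have := χ_eq_zero_or_one n
  split_ifs with h <;> rw [mem_S₁'_iff] at h
  · exact h.symm
  · omega

theorem charSeq_S₁ : charSeq S₁ = fun n => χ (n / 2) := by
  classical
  funext n
  rw [charSeq, Set.indicator_apply]
  have := χ_eq_zero_or_one (n / 2)
  split_ifs with h <;> rw [mem_S₁_iff] at h
  · exact h.symm
  · omega

/-! ### Automaticity -/

theorem isAutomatic_two_of_finite {α : Type*} {a : ℕ → α} {A : Set (ℕ → α)} (hA : A.Finite)
    (ha : a ∈ A) (h0 : ∀ f ∈ A, (fun n => f (2 * n)) ∈ A)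
    (h1 : ∀ f ∈ A, (fun n => f (2 * n + 1)) ∈ A) : IsAutomatic 2 a := by
  refine ⟨le_rfl, hA.subset ?_⟩
  rintro _ ⟨j, i, hi, rfl⟩
  induction j generalizing i with
  | zero =>
    have : i = 0 := by omega
    simpa [this] using ha
  | succ j ih =>
    rw [pow_succ] at hi
    rcases lt_or_ge i (2 ^ j) with h | h
    · convert h0 _ (ih i h) using 2 with n
      rw [pow_succ, mul_assoc]
    · convert h1 _ (ih (i - 2 ^ j) (by omega)) using 2 with n
      rw [pow_succ, mul_add, mul_one, mul_assoc]
      congr 1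
      omega

theorem T_two_mul (n : ℕ) : T (2 * n) = T n := by rw [T, s₂_two_mul, T]

theorem T_two_mul_add_one (n : ℕ) : T (2 * n + 1) = 1 - T n := by
  rw [T, s₂_two_mul_add_one, T]; omega

/-- A finite set of sequences containing the `2`-kernel of `χ`. -/
def kernelBound : Set (ℕ → ℕ) :=
  {χ, fun n => χ (2 * n), fun n => χ (4 * n + 2), T, fun n => 1 - T n, fun _ => 0}

theorem even_mem_kernelBound {f : ℕ → ℕ} (hf : f ∈ kernelBound) :
    (fun n => f (2 * n)) ∈ kernelBound := by
  simp only [kernelBound, Set.mem_insert_iff, Set.mem_singleton_iff] at hf ⊢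
  rcases hf with rfl | rfl | rfl | rfl | rfl | rfl
  · simp
  · left; funext n; dsimp only; rw [← mul_assoc]; exact χ_four_mul n
  · right; right; right; left
    funext n; dsimp only; rw [← mul_assoc]; exact χ_eight_mul_add_two n
  · right; right; right; left
    funext n; exact T_two_mul n
  · right; right; right; right; left
    funext n; dsimp only; rw [T_two_mul]
  · simp

theorem odd_mem_kernelBound {f : ℕ → ℕ} (hf : f ∈ kernelBound) :
    (fun n => f (2 * n + 1)) ∈ kernelBound := by
  simp only [kernelBound, Set.mem_insert_iff, Set.mem_singleton_iff] at hf ⊢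
  rcases hf with rfl | rfl | rfl | rfl | rfl | rfl
  · right; right; right; right; right
    funext n; exact χ_two_mul_add_one n
  · right; right; left
    funext n; dsimp only; congr 1; ring
  · right; right; right; right; right
    funext n; dsimp only; rw [← χ_eight_mul_add_six n]; congr 1; ring
  · right; right; right; right; left
    funext n; exact T_two_mul_add_one n
  · right; right; right; left
    funext n
    have := t_eq_one_or n
    dsimp only
    rw [T_two_mul_add_one]; omega
  · simp

theorem finite_kernelBound : kernelBound.Finite := by
  unfold kernelBound
  exact Set.toFinite _

theorem isAutomatic_χ : IsAutomatic 2 χ :=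
  isAutomatic_two_of_finite finite_kernelBound (Or.inl rfl)
    (fun _ => even_mem_kernelBound) fun _ => odd_mem_kernelBound

theorem isAutomaticSet_S₁ : IsAutomaticSet 2 S₁ := by
  rw [IsAutomaticSet, charSeq_S₁]
  refine isAutomatic_two_of_finite (finite_kernelBound.insert fun n => χ (n / 2))
    (Or.inl rfl) ?_ ?_
  · rintro f (rfl | hf)
    · refine Or.inr (Or.inl ?_)
      funext n
      dsimp only
      rw [Nat.mul_div_cancel_left n two_pos]
    · exact Or.inr (even_mem_kernelBound hf)
  · rintro f (rfl | hf)
    · refine Or.inr (Or.inl ?_)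
      funext n
      dsimp only
      rw [(by omega : (2 * n + 1) / 2 = n)]
    · exact Or.inr (odd_mem_kernelBound hf)

end BinaryPartition

theorem mainTheorem1 :
    (∀ n : ℕ, List.TFAE [
      ¬ BinaryPartition.IsSumThreeSquares (BinaryPartition.b (2 * n)),
      ∃ k s : ℕ, n = 2 ^ (2 * k + 1) * (4 * s + 1) ∧ BinaryPartition.t s = -1,
      ∃ k r : ℕ, (n : ℤ) = 2 ^ (2 * k + 1) * (8 * (r : ℤ) + 2 * BinaryPartition.t r + 3),
      BinaryPartition.χ n = 1]) ∧
    (∀ n : ℕ, BinaryPartition.b (2 * n + 1) = BinaryPartition.b (2 * n)) ∧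
    BinaryPartition.S₁ =
      (fun n => 2 * n) '' BinaryPartition.S₁' ∪ (fun n => 2 * n + 1) '' BinaryPartition.S₁' ∧
    BinaryPartition.S₁ = {n : ℕ | ∃ k r i : ℕ, (i = 0 ∨ i = 1) ∧
      (n : ℤ) = 2 ^ (2 * k + 2) * (8 * (r : ℤ) + 2 * BinaryPartition.t r + 3) + i} ∧
    BinaryPartition.charSeq BinaryPartition.S₁' = BinaryPartition.χ ∧
    BinaryPartition.IsAutomatic 2 BinaryPartition.χ ∧
    BinaryPartition.IsAutomaticSet 2 BinaryPartition.S₁' ∧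
    BinaryPartition.IsAutomaticSet 2 BinaryPartition.S₁ := by
  open BinaryPartition in
  refine ⟨fun n => ?_, b_two_mul_add_one, ?_, ?_, charSeq_S₁', isAutomatic_χ, ?_,
    isAutomaticSet_S₁⟩
  · tfae_have 1 ↔ 4 := not_isSumThreeSquares_bEven_iff n
    tfae_have 4 ↔ 2 := χ_eq_one_iff_exists n
    tfae_have 4 ↔ 3 := χ_eq_one_iff_exists' n
    tfae_finish
  · ext n
    rw [mem_S₁_iff, ← mem_S₁'_iff]
    constructor
    · intro h
      rcases Nat.mod_two_eq_zero_or_one n with h' | h'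
      · exact Or.inl ⟨n / 2, h, by dsimp only; omega⟩
      · exact Or.inr ⟨n / 2, h, by dsimp only; omega⟩
    · rintro (⟨m, hm, rfl⟩ | ⟨m, hm, rfl⟩)
      · rwa [Nat.mul_div_cancel_left m two_pos]
      · rwa [(by omega : (2 * m + 1) / 2 = m)]
  · ext n
    rw [mem_S₁_iff, χ_eq_one_iff_exists']
    refine exists_congr fun k => exists_congr fun r => ⟨fun h => ?_, ?_⟩
    · refine ⟨n % 2, by omega, ?_⟩
      rw [pow_succ, mul_right_comm, ← h]
      omega
    · rintro ⟨i, hi, h⟩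
      rw [pow_succ, mul_right_comm] at h
      omega
  · rw [IsAutomaticSet, charSeq_S₁']
    exact isAutomatic_χ
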